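/- All topological groups are Hausdorff (but the topologies in the definition of the Bohr topology below need not be). Let $G$ be a topological group with neutral element $e$. A unitary representation of $G$ is a homomorphism $\rho$ from $G$ to the unitary group of a complex Hilbert space $\mathcal H$ such that $g\mapsto\rho(g)v$ is continuous for every $v\in\mathcal H$. It is irreducible if $\mathcal H\neq 0$ and the only closed invariant subspaces are $0$ and $\mathcal H$. For $n\ge 1$ let $\widehat G_n$ be the set of unitary equivalence classes of $n$-dimensional irreducible unitary representations of $G$, and let $1_G$ be the class of the trivial one-dimensional representation. For a unitary representation $\rho$ let $P_\rho$ be the set of all finite sums of functions $g\mapsto(\rho(g)v,v)$ with $v\in\mathcal H$; it depends only on the class $[\rho]$. A set $\mathcal R$ of equivalence classes of unitary representations of $G$ carries the Fell topology, in which the basic neighbourhoods of $[\rho]\in\mathcal R$ are the sets $$W(f_1,\dots,f_k,C,\varepsilon)=\{[\sigma]\in\mathcal R:\ \exists\, g_1,\dots,g_k\in P_\sigma\ \ \forall x\in C\ \forall i\ \ |f_i(x)-g_i(x)|<\varepsilon\},$$ where $f_1,\dots,f_k\in P_\rho$, $C\subseteq G$ is compact and $\varepsilon>0$. The weight $w(X)$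 of a topological space $X$ is the least cardinality of a base of $X$ (possibly finite). A group topology on $G$, not necessarily Hausdorff, is called precompact if it is induced by a homomorphism from $G$ to a compact Hausdorff group. The Bohr topology of $G$ is the finest precompact group topology on $G$ that is coarser than the given topology, and the Bohr compactification $bG$ is the Hausdorff completion of $G$ with respect to the Bohr topology. **Theorem.** Suppose that for every $n\ge 1$ the point $1_G$ is isolated in $\widehat G_n\cup\{1_G\}$ with the Fell topology. Then: 1. if $\kappa$ is a cardinal such that $w(K)\le\kappa$ for every compact subset $K$ of $G$, then $w(bG)\le\kappa$; 2. if every compact subset of $G$ is metrizable, then $bG$ is metrizable. -/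

import Mathlib

universe u

/-! ### Weight -/

/-- The weight of a topological space: the least cardinality of a base. -/
noncomputable def weight (X : Type u) [TopologicalSpace X] : Cardinal.{u} :=
  sInf {c : Cardinal.{u} |
    ∃ B : Set (Set X), TopologicalSpace.IsTopologicalBasis B ∧ Cardinal.mk B = c}

/-! ### Unitary representations and the Fell topology -/

/-- A unitary representation of `G`: a homomorphism into the unitary group of a complex Hilbert
space, continuous for the strong operator topology. -/
structure UnitaryRep (G : Type u) [Group G] [TopologicalSpace G] where
  /-- the Hilbert space of the representation -/
  H : Type u
  [normedAddCommGroup : NormedAddCommGroup H]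
  [innerProductSpace : InnerProductSpace ℂ H]
  [completeSpace : CompleteSpace H]
  /-- the homomorphism into the unitary group -/
  toHom : G →* (H ≃ₗᵢ[ℂ] H)
  continuous_apply : ∀ v : H, Continuous fun g : G => toHom g v

attribute [instance] UnitaryRep.normedAddCommGroup UnitaryRep.innerProductSpace
  UnitaryRep.completeSpace

namespace UnitaryRep

variable {G : Type u} [Group G] [TopologicalSpace G]

/-- Unitary equivalence of unitary representations. -/
def Equivalent (ρ ψ : UnitaryRep G) : Prop :=
  ∃ M : ρ.H ≃ₗᵢ[ℂ] ψ.H, ∀ (x : G) (v : ρ.H), M (ρ.toHom x v) = ψ.toHom x (M v)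

/-- A representation on a non-zero Hilbert space without proper non-zero closed invariant
subspaces. -/
def IsIrreducible (ρ : UnitaryRep G) : Prop :=
  Nontrivial ρ.H ∧
    ∀ E : Submodule ℂ ρ.H, IsClosed (E : Set ρ.H) →
      (∀ g : G, ∀ v ∈ E, ρ.toHom g v ∈ E) → E = ⊥ ∨ E = ⊤

/-- The functions of positive type associated with `ρ`, that is, `g ↦ (ρ(g)v, v)`. Mathlib's
inner product is linear in its second argument. -/
def posType (ρ : UnitaryRep G) : Set (G → ℂ) :=
  {f | ∃ v : ρ.H, f = fun g => inner ℂ v (ρ.toHom g v)}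

/-- The set of finite sums of functions of positive type associated with `ρ`; this is the convex
cone which these functions generate. -/
def posCone (ρ : UnitaryRep G) : Set (G → ℂ) :=
  (AddSubmonoid.closure ρ.posType : Set (G → ℂ))

/-- The trivial one-dimensional representation. -/
noncomputable def trivial (G : Type u) [Group G] [TopologicalSpace G] : UnitaryRep G where
  H := EuclideanSpace ℂ PUnit.{u + 1}
  toHom := 1
  continuous_apply _ := continuous_const

theorem Equivalent.refl (ρ : UnitaryRep G) : ρ.Equivalent ρ :=
  ⟨LinearIsometryEquiv.refl ℂ ρ.H, fun _ _ => rfl⟩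

theorem Equivalent.symm {ρ ψ : UnitaryRep G} (h : ρ.Equivalent ψ) : ψ.Equivalent ρ := by
  obtain ⟨M, hM⟩ := h
  refine ⟨M.symm, fun x v => M.injective ?_⟩
  rw [hM]
  simp

theorem Equivalent.trans {ρ ψ τ : UnitaryRep G} (h : ρ.Equivalent ψ) (h' : ψ.Equivalent τ) :
    ρ.Equivalent τ := by
  obtain ⟨M, hM⟩ := h
  obtain ⟨N, hN⟩ := h'
  exact ⟨M.trans N, fun x v => by simp [hM, hN]⟩

theorem Equivalent.posType_subset {ρ ψ : UnitaryRep G} (h : ρ.Equivalent ψ) :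
    ρ.posType ⊆ ψ.posType := by
  obtain ⟨M, hM⟩ := h
  rintro f ⟨v, rfl⟩
  refine ⟨M v, ?_⟩
  funext g
  rw [← hM, LinearIsometryEquiv.inner_map_map]

theorem Equivalent.posCone_eq {ρ ψ : UnitaryRep G} (h : ρ.Equivalent ψ) :
    ρ.posCone = ψ.posCone := by
  have e : ρ.posType = ψ.posType := Set.Subset.antisymm h.posType_subset h.symm.posType_subset
  unfold posCone
  rw [e]

/-- Unitary equivalence as a setoid. -/
instance setoid (G : Type u) [Group G] [TopologicalSpace G] : Setoid (UnitaryRep G) where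
  r := Equivalent
  iseqv := ⟨Equivalent.refl, Equivalent.symm, Equivalent.trans⟩

end UnitaryRep

/-- Equivalence classes of unitary representations of `G`. -/
def RepClass (G : Type u) [Group G] [TopologicalSpace G] : Type (u + 1) :=
  Quotient (UnitaryRep.setoid G)

namespace RepClass

variable {G : Type u} [Group G] [TopologicalSpace G]

/-- The class of a unitary representation. -/
def mk (ρ : UnitaryRep G) : RepClass G := Quotient.mk (UnitaryRep.setoid G) ρ

/-- The convex cone of sums of functions of positive type associated with a class. -/
def posCone (c : RepClass G) : Set (G → ℂ) :=
  Quotient.lift UnitaryRep.posCone (fun _ _ h => UnitaryRep.Equivalent.posCone_eq h) c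

/-- The class `1_G` of the trivial representation. -/
noncomputable def one (G : Type u) [Group G] [TopologicalSpace G] : RepClass G :=
  mk (UnitaryRep.trivial G)

/-- The basic neighbourhood `W(f₁, …, fₖ, C, ε)` in a set `R` of classes. -/
def fellNhd (R : Set (RepClass G)) {k : ℕ} (f : Fin k → G → ℂ) (C : Set G) (ε : ℝ) : Set R :=
  {d | ∃ p : Fin k → G → ℂ, (∀ i, p i ∈ posCone d.1) ∧
    ∀ x ∈ C, ∀ i, ‖f i x - p i x‖ < ε}

/-- The Fell topology on a set `R` of classes of unitary representations: a set is open if with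
each of its points `c` it contains a neighbourhood `W(f₁, …, fₖ, C, ε)`, where the `fᵢ` lie in the
cone of `c`, `C` is compact and `ε > 0`. -/
@[reducible] def fellTopology (R : Set (RepClass G)) : TopologicalSpace R where
  IsOpen U := ∀ c ∈ U, ∃ (k : ℕ) (f : Fin k → G → ℂ) (C : Set G) (ε : ℝ),
    (∀ i, f i ∈ posCone c.1) ∧ IsCompact C ∧ 0 < ε ∧ fellNhd R f C ε ⊆ U
  isOpen_univ _ _ :=
    ⟨0, Fin.elim0, ∅, 1, fun i => i.elim0, isCompact_empty, one_pos, Set.subset_univ _⟩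
  isOpen_inter := by
    rintro U V hU hV c ⟨hcU, hcV⟩
    obtain ⟨k, f, C, ε, hf, hC, hε, h⟩ := hU c hcU
    obtain ⟨k', f', C', ε', hf', hC', hε', h'⟩ := hV c hcV
    refine ⟨k + k', Fin.append f f', C ∪ C', min ε ε', ?_, hC.union hC', lt_min hε hε', ?_⟩
    · intro i
      induction i using Fin.addCases with
      | left i => simpa using hf i
      | right i => simpa using hf' i
    · rintro d ⟨p, hp, hd⟩
      constructor
      · refine h ⟨fun i => p (Fin.castAdd k' i), fun i => hp _, fun x hx i => ?_⟩
        have := hd x (Or.inl hx) (Fin.castAdd k' i)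
        rw [Fin.append_left] at this
        exact this.trans_le (min_le_left _ _)
      · refine h' ⟨fun i => p (Fin.natAdd k i), fun i => hp _, fun x hx i => ?_⟩
        have := hd x (Or.inr hx) (Fin.natAdd k i)
        rw [Fin.append_right] at this
        exact this.trans_le (min_le_right _ _)
  isOpen_sUnion := by
    rintro S hS c ⟨U, hUS, hcU⟩
    obtain ⟨k, f, C, ε, hf, hC, hε, h⟩ := hS U hUS c hcU
    exact ⟨k, f, C, ε, hf, hC, hε, h.trans (Set.subset_sUnion_of_mem hUS)⟩

/-- The class `c` is an isolated point of `R ∪ {c}` with the Fell topology. -/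
def IsIsolatedIn (c : RepClass G) (R : Set (RepClass G)) : Prop :=
  (fellTopology (R ∪ {c})).IsOpen {⟨c, Or.inr rfl⟩}

end RepClass

/-- The dual object of `G`: the classes of irreducible unitary representations. -/
def dualObject (G : Type u) [Group G] [TopologicalSpace G] : Set (RepClass G) :=
  {c | ∃ ρ : UnitaryRep G, RepClass.mk ρ = c ∧ ρ.IsIrreducible}

/-- The classes of `n`-dimensional irreducible unitary representations. -/
def dualObjectDim (G : Type u) [Group G] [TopologicalSpace G] (n : ℕ) : Set (RepClass G) :=
  {c ∈ dualObject G | ∃ ρ : UnitaryRep G, RepClass.mk ρ = c ∧ Module.rank ℂ ρ.H = n}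

/-! ### The Bohr compactification -/

/-- A topology on the group `G` is precompact if it is induced by a homomorphism to a compact
Hausdorff group. It is not required to be Hausdorff, so that the Bohr topology exists for every
topological group. -/
def IsPrecompactTopology {G : Type u} [Group G] (s : TopologicalSpace G) : Prop :=
  ∃ (K : Type u) (_ : Group K) (_ : TopologicalSpace K) (φ : G →* K),
    IsTopologicalGroup K ∧ CompactSpace K ∧ T2Space K ∧ s = TopologicalSpace.induced φ inferInstance

/-- The Bohr topology: the finest precompact group topology coarser than the topology of `G`. In
Mathlib's order on topologies `t ≤ s` means that `t` is finer than `s`. -/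
@[reducible] def bohrTopology (G : Type u) [Group G] [t : TopologicalSpace G] : TopologicalSpace G :=
  sInf {s | t ≤ s ∧ IsPrecompactTopology s}

theorem bohrTopology_isLeast (G : Type u) [Group G] [t : TopologicalSpace G] :
    IsLeast {s | t ≤ s ∧ IsPrecompactTopology s} (bohrTopology G) := by
  refine ⟨⟨le_sInf fun s hs => hs.1, ?_⟩, fun s hs => sInf_le hs⟩
  choose K gK tK φ h1 h2 h3 h4 using
    fun s : {s : TopologicalSpace G | t ≤ s ∧ IsPrecompactTopology s} => s.2.2
  refine ⟨∀ s, K s, inferInstance, inferInstance, MonoidHom.pi φ, inferInstance, inferInstance,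
    inferInstance, ?_⟩
  have e : bohrTopology G = ⨅ s : {s : TopologicalSpace G | t ≤ s ∧ IsPrecompactTopology s},
      (s : TopologicalSpace G) := sInf_eq_iInf' _
  rw [e]
  simp only [Pi.topologicalSpace, induced_iInf, induced_compose]
  exact iInf_congr fun s => h4 s

/-- The group `G` endowed with its Bohr topology. -/
def BohrGroup (G : Type u) [Group G] [TopologicalSpace G] : Type u := G

namespace BohrGroup

variable (G : Type u) [Group G] [TopologicalSpace G]

instance : Group (BohrGroup G) := inferInstanceAs (Group G)

instance : TopologicalSpace (BohrGroup G) := bohrTopology G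

theorem exists_isInducing : ∃ (K : Type u) (_ : Group K) (_ : TopologicalSpace K)
    (φ : BohrGroup G →* K), IsTopologicalGroup K ∧ CompactSpace K ∧ T2Space K ∧
      Topology.IsInducing φ := by
  obtain ⟨K, gK, tK, φ, h1, h2, h3, h4⟩ := (bohrTopology_isLeast G).1.2
  exact ⟨K, gK, tK, φ, h1, h2, h3, ⟨h4⟩⟩

instance : IsTopologicalGroup (BohrGroup G) := by
  obtain ⟨K, gK, tK, φ, h1, h2, h3, h4⟩ := exists_isInducing G
  rw [h4.eq_induced]
  exact topologicalGroup_induced φ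

/-- The (right) uniformity of the Bohr topology; it coincides with the left one. -/
instance : UniformSpace (BohrGroup G) := IsTopologicalGroup.rightUniformSpace (BohrGroup G)

theorem exists_isUniformInducing : ∃ (K : Type u) (_ : Group K) (_ : UniformSpace K)
    (φ : BohrGroup G →* K), IsUniformGroup K ∧ CompactSpace K ∧ IsUniformInducing φ := by
  obtain ⟨K, gK, tK, φ, h1, h2, h3, h4⟩ := exists_isInducing G
  let _ : UniformSpace K := IsTopologicalGroup.rightUniformSpace K
  refine ⟨K, gK, inferInstance, φ, IsUniformGroup.of_compactSpace, h2, ⟨?_⟩⟩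
  change Filter.comap _ (Filter.comap (fun p : K × K => p.2 * p.1⁻¹) (nhds 1)) =
    Filter.comap (fun p : BohrGroup G × BohrGroup G => p.2 * p.1⁻¹) (nhds 1)
  rw [h4.nhds_eq_comap, Filter.comap_comap, Filter.comap_comap, map_one]
  congr 1
  funext p
  simp

instance : IsUniformGroup (BohrGroup G) := by
  obtain ⟨K, gK, uK, φ, h1, h2, h3⟩ := exists_isUniformInducing G
  exact h3.isUniformGroup φ

instance : IsUniformAddGroup (Additive (BohrGroup G)) :=
  ⟨uniformContinuous_div (α := BohrGroup G)⟩

theorem totallyBounded_univ : TotallyBounded (Set.univ : Set (BohrGroup G)) := by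
  obtain ⟨K, gK, uK, φ, h1, h2, h3⟩ := exists_isUniformInducing G
  exact totallyBounded_preimage h3 (isCompact_univ (X := K)).totallyBounded

end BohrGroup

/-- The Bohr compactification `bG`: the (Hausdorff) completion of `G` with the Bohr topology.
Mathlib has the group structure on completions in additive notation only, whence the two type
tags. -/
def BohrCompactification (G : Type u) [Group G] [TopologicalSpace G] : Type u :=
  Multiplicative (UniformSpace.Completion (Additive (BohrGroup G)))

namespace BohrCompactification

variable (G : Type u) [Group G] [TopologicalSpace G]

noncomputable instance : Group (BohrCompactification G) :=
  inferInstanceAs (Group (Multiplicative (UniformSpace.Completion (Additive (BohrGroup G)))))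

instance : TopologicalSpace (BohrCompactification G) :=
  inferInstanceAs (TopologicalSpace (UniformSpace.Completion (Additive (BohrGroup G))))

instance : IsTopologicalGroup (BohrCompactification G) :=
  inferInstanceAs (IsTopologicalGroup
    (Multiplicative (UniformSpace.Completion (Additive (BohrGroup G)))))

instance : T2Space (BohrCompactification G) :=
  inferInstanceAs (T2Space (UniformSpace.Completion (Additive (BohrGroup G))))

instance : CompactSpace (BohrCompactification G) := by
  have h : TotallyBounded (Set.univ : Set (UniformSpace.Completion (Additive (BohrGroup G)))) := by
    have h' := (BohrGroup.totallyBounded_univ G).image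
      (UniformSpace.Completion.uniformContinuous_coe (Additive (BohrGroup G)))
    have d := (UniformSpace.Completion.denseRange_coe (α := Additive (BohrGroup G))).closure_range
    rw [← d, ← Set.image_univ]
    exact h'.closure
  exact ⟨h.isCompact_of_isClosed isClosed_univ⟩

end BohrCompactification

/-! Isolation of `1_G` is a rigidity statement. For each `N` it yields a compact `C ⊆ G` and `δ > 0`
such that an irreducible representation of dimension at most `N` with a non-zero vector moved on `C`
by at most `δ` times its norm is trivial (`exists_forall_toHom_eq_self_of_rank_le`). Splitting off
invariant subspaces costs a bounded factor, so a possibly reducible representation of dimension at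
most `N` with a sufficiently invariant vector has a non-zero fixed vector
(`exists_invariant_vector`).

Apply this to the action `A ↦ V(g) A U(g)⁻¹` on `n × n` matrices, where `N = n²`. If `U` and `V` are
uniformly close on `C`, the identity matrix is almost invariant, so there is a non-zero intertwiner
(`exists_intertwiner`). If `U` is irreducible, Schur's argument makes it invertible. Hence an
irreducible `n`-dimensional representation of `bG` is determined, up to similarity, by its
approximate values on one compact set.

For infinite `κ ≥ w(C)`, a family of continuous matrix-valued functions on `C` has a uniformly
`δ`-dense subfamily of size at most `κ` (`exists_small_uniformly_dense`). So for each `n` at most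
`κ` representations suffice. By Peter–Weyl (`exists_isIrreducibleHom_ne`) their matrix entries, over
all `n`, separate the points of the compact space `bG` and embed it in a product of at most `κ`
copies of `ℂ`. A finite `κ` forces `G` to be finite. -/

namespace UnitaryRep

/-! ### Invariant subspaces and subrepresentations. -/

section Basics

variable {G : Type u} [Group G] [TopologicalSpace G]

/-- A unitary representation from an isometric linear action. -/
noncomputable abbrev ofLinearIsometry (H : Type u) [NormedAddCommGroup H] [InnerProductSpace ℂ H]
    [CompleteSpace H] (f : G → H →ₗ[ℂ] H) (one : f 1 = LinearMap.id)
    (mul : ∀ g h, f (g * h) = f g ∘ₗ f h) (norm : ∀ g v, ‖f g v‖ = ‖v‖)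
    (cont : ∀ v, Continuous fun g => f g v) : UnitaryRep G where
  H := H
  toHom :=
    { toFun := fun g =>
        { toLinearEquiv := LinearEquiv.ofLinearMap (f g) (f g⁻¹)
            (by rw [← mul, mul_inv_cancel, one]) (by rw [← mul, inv_mul_cancel, one])
          norm_map' := norm g }
      map_one' := by ext v; exact LinearMap.congr_fun one v
      map_mul' := fun g h => by ext v; exact LinearMap.congr_fun (mul g h) v }
  continuous_apply := cont

/-- A submodule stable under a unitary representation. -/
def IsInvariant (ρ : UnitaryRep G) (E : Submodule ℂ ρ.H) : Prop :=
  ∀ g : G, ∀ v ∈ E, ρ.toHom g v ∈ E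

theorem toHom_mul_apply (ρ : UnitaryRep G) (g h : G) (v : ρ.H) :
    ρ.toHom (g * h) v = ρ.toHom g (ρ.toHom h v) := by
  rw [map_mul, LinearIsometryEquiv.coe_mul, Function.comp_apply]

theorem inner_toHom_left (ρ : UnitaryRep G) (g : G) (v w : ρ.H) :
    inner ℂ (ρ.toHom g v) w = inner ℂ v (ρ.toHom g⁻¹ w) := by
  rw [← (ρ.toHom g⁻¹).inner_map_map, ← toHom_mul_apply]
  simp

theorem IsInvariant.orthogonal {ρ : UnitaryRep G} {E : Submodule ℂ ρ.H} (hE : ρ.IsInvariant E) :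
    ρ.IsInvariant Eᗮ := by
  intro g v hv
  rw [Submodule.mem_orthogonal'] at hv ⊢
  intro u hu
  rw [inner_toHom_left]
  exact hv _ (hE _ _ hu)

/-- The restriction of a unitary representation to a complete invariant submodule. -/
noncomputable abbrev sub (ρ : UnitaryRep G) (E : Submodule ℂ ρ.H) [CompleteSpace E]
    (hE : ρ.IsInvariant E) : UnitaryRep G :=
  ofLinearIsometry E
    (fun g => (ρ.toHom g).toLinearEquiv.toLinearMap.restrict (hE g))
    (by ext v; simp) (fun g h => by ext v; simp) (fun g v => by simp)
    (fun v => Continuous.subtype_mk (ρ.continuous_apply v) _)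

theorem IsInvariant.map_subtype {ρ : UnitaryRep G} {E : Submodule ℂ ρ.H} [CompleteSpace E]
    {hE : ρ.IsInvariant E} {F : Submodule ℂ E} (hF : (ρ.sub E hE).IsInvariant F) :
    ρ.IsInvariant (F.map E.subtype) := by
  rintro g _ ⟨v, hv, rfl⟩
  exact ⟨_, hF g v hv, rfl⟩

theorem isIrreducible_sub (ρ : UnitaryRep G) {E : Submodule ℂ ρ.H} [CompleteSpace E]
    (hE : ρ.IsInvariant E) (hne : E ≠ ⊥)
    (hmin : ∀ F ≤ E, ρ.IsInvariant F → F = ⊥ ∨ F = E) : (ρ.sub E hE).IsIrreducible := by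
  refine ⟨Submodule.nontrivial_iff_ne_bot.2 hne, fun (F : Submodule ℂ E) _ hF => ?_⟩
  have hF' : (ρ.sub E hE).IsInvariant F := hF
  refine (hmin _ (Submodule.map_subtype_le E F)
    (IsInvariant.map_subtype (E := E) (hE := hE) hF')).imp (fun h => ?_) (fun h => ?_)
  · exact Submodule.map_injective_of_injective E.injective_subtype (h.trans (Submodule.map_bot _).symm)
  · apply Submodule.map_injective_of_injective E.injective_subtype
    exact h.trans (Submodule.map_subtype_top E).symm

/-- Take a non-zero invariant subspace of `E` of least dimension. -/
theorem exists_minimal_invariant (ρ : UnitaryRep G) {E : Submodule ℂ ρ.H}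
    [FiniteDimensional ℂ E] (hE : ρ.IsInvariant E) (hne : E ≠ ⊥) :
    ∃ F ≤ E, ρ.IsInvariant F ∧ F ≠ ⊥ ∧ ∀ F' ≤ F, ρ.IsInvariant F' → F' = ⊥ ∨ F' = F := by
  classical
  let P : ℕ → Prop := fun n =>
    ∃ F ≤ E, ρ.IsInvariant F ∧ F ≠ ⊥ ∧ Module.finrank ℂ F = n
  have hP : ∃ n, P n := ⟨_, E, le_rfl, hE, hne, rfl⟩
  obtain ⟨F, hFE, hF, hF0, hFn⟩ := Nat.find_spec hP
  refine ⟨F, hFE, hF, hF0, fun F' hF' hinv => or_iff_not_imp_left.2 fun h0 => ?_⟩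
  have : FiniteDimensional ℂ F := Submodule.finiteDimensional_of_le hFE
  refine Submodule.eq_of_le_of_finrank_le hF' ?_
  rw [hFn]
  exact Nat.find_min' hP ⟨F', hF'.trans hFE, hinv, h0, rfl⟩

end Basics

/-! ### Finite-dimensional subrepresentations for compact groups. -/

section Compact

open MeasureTheory

variable {K : Type u} [Group K] [TopologicalSpace K] [IsTopologicalGroup K] [CompactSpace K]

/-- A non-zero unitary representation of a compact group has a non-zero finite-dimensional
invariant subspace. -/
theorem exists_finiteDimensional_invariant (ρ : UnitaryRep K) [Nontrivial ρ.H] :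
    ∃ E : Submodule ℂ ρ.H, FiniteDimensional ℂ E ∧ ρ.IsInvariant E ∧ E ≠ ⊥ := by
  borelize K
  let μ : Measure K := Measure.haarMeasure ⊤
  have hprob : IsProbabilityMeasure μ := ⟨Measure.haarMeasure_self (K₀ := ⊤)⟩
  obtain ⟨v, hv⟩ := exists_ne (0 : ρ.H)
  let f : K → ρ.H →L[ℂ] ρ.H := fun g =>
    InnerProductSpace.rankOne ℂ (ρ.toHom g v) (ρ.toHom g v)
  have hf : Continuous f := by
    exact ((ContinuousLinearMap.smulRightL ℂ ρ.H ρ.H).continuous.comp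
      ((innerSL ℂ).continuous.comp (ρ.continuous_apply v))).clm_apply (ρ.continuous_apply v)
  have hfi : Integrable f μ := hf.integrable_of_hasCompactSupport (HasCompactSupport.of_compactSpace f)
  have hfw (w : ρ.H) : Continuous fun g => inner ℂ (ρ.toHom g v) w • ρ.toHom g v := by
    have := ρ.continuous_apply v
    fun_prop
  -- Averaging the rank-one operators attached to the orbit of `v` gives an intertwiner that is
  -- compact and self-adjoint, because both properties define closed real subspaces of operators.
  set T : ρ.H →L[ℂ] ρ.H := ∫ g, f g ∂μ with hT
  have hTw (w : ρ.H) : T w = ∫ g, inner ℂ (ρ.toHom g v) w • ρ.toHom g v ∂μ := by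
    rw [hT, ContinuousLinearMap.integral_apply hfi]
    rfl
  have hcompact : IsCompactOperator T := by
    let S := (compactOperator (RingHom.id ℂ) ρ.H ρ.H).restrictScalars ℝ
    have hS : IsClosed (S : Set (ρ.H →L[ℂ] ρ.H)) := isClosed_setOfPred_isCompactOperator
    refine S.convex.integral_mem hS (Filter.Eventually.of_forall fun g => ?_) hfi
    change IsCompactOperator (f g)
    have : f g = (ContinuousLinearMap.toSpanSingleton ℂ (ρ.toHom g v)) ∘L
        innerSL ℂ (ρ.toHom g v) := InnerProductSpace.rankOne_def' _ _
    rw [this]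
    exact (isCompactOperator_of_locallyCompactSpace_dom (innerSL ℂ (ρ.toHom g v))).clm_comp
      (ContinuousLinearMap.toSpanSingleton ℂ (ρ.toHom g v))
  have hsymm : T.IsSymmetric := by
    let S : Submodule ℝ (ρ.H →L[ℂ] ρ.H) := selfAdjoint.submodule ℝ (ρ.H →L[ℂ] ρ.H)
    have hS : IsClosed (S : Set (ρ.H →L[ℂ] ρ.H)) := by
      change IsClosed {x : ρ.H →L[ℂ] ρ.H | star x = x}
      exact isClosed_eq continuous_star continuous_id
    have : T ∈ S := by
      refine S.convex.integral_mem hS (Filter.Eventually.of_forall fun g => ?_) hfi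
      change IsSelfAdjoint (f g)
      rw [ContinuousLinearMap.isSelfAdjoint_iff_isSymmetric]
      intro x y
      simp [f, inner_smul_left, inner_smul_right, mul_comm]
    exact (ContinuousLinearMap.isSelfAdjoint_iff_isSymmetric (A := T)).1 this
  have hcomm (h : K) (w : ρ.H) : T (ρ.toHom h w) = ρ.toHom h (T w) := by
    rw [hTw, hTw, ← integral_mul_left_eq_self _ h]
    have e : ∀ g, inner ℂ (ρ.toHom (h * g) v) (ρ.toHom h w) • ρ.toHom (h * g) v =
        (ρ.toHom h).toContinuousLinearEquiv.toContinuousLinearMap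
          (inner ℂ (ρ.toHom g v) w • ρ.toHom g v) := by
      intro g
      rw [toHom_mul_apply, LinearIsometryEquiv.inner_map_map]
      simp
    simp_rw [e]
    rw [ContinuousLinearMap.integral_comp_comm]
    · rfl
    · exact (hfw w).integrable_of_hasCompactSupport (HasCompactSupport.of_compactSpace _)
  -- `⟨v, T v⟩` is the integral of `|⟨ρ(g)v, v⟩|²`, which is continuous and non-zero at `g = 1`.
  have hne : T ≠ 0 := by
    intro h0
    have h1 : inner ℂ v (T v) = 0 := by simp [h0]
    have hi : Integrable (fun g => inner ℂ (ρ.toHom g v) v • ρ.toHom g v) μ :=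
      (hfw v).integrable_of_hasCompactSupport (HasCompactSupport.of_compactSpace _)
    rw [hTw, ← integral_inner hi] at h1
    have e : ∀ g, inner ℂ v (inner ℂ (ρ.toHom g v) v • ρ.toHom g v) =
        ((‖inner ℂ (ρ.toHom g v) v‖ ^ 2 : ℝ) : ℂ) := by
      intro g
      rw [inner_smul_right, ← inner_conj_symm v, RCLike.mul_conj]
      norm_cast
    simp_rw [e] at h1
    rw [integral_complex_ofReal] at h1
    have hc : Continuous fun g => ‖inner ℂ (ρ.toHom g v) v‖ ^ 2 := by
      have := ρ.continuous_apply v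
      fun_prop
    have hpos := hc.integral_pos_of_hasCompactSupport_nonneg_nonzero (μ := μ) (x := 1)
      (HasCompactSupport.of_compactSpace _) (fun g => by positivity) (by simp [hv])
    exact hpos.ne' (by exact_mod_cast h1)
  -- By the spectral theorem `T` has a non-zero eigenvalue. Its eigenspace is finite-dimensional by
  -- compactness and invariant because `T` commutes with the action.
  have := mt (ContinuousLinearMap.eq_zero_of_forall_hasEigenvalue_eq_zero hcompact hsymm).1 hne
  push Not at this
  obtain ⟨c, hc, hc0⟩ := this
  refine ⟨_, ContinuousLinearMap.finite_dimensional_eigenspace hcompact c hc0, ?_, Module.End.hasEigenvalue_iff.1 hc⟩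
  intro g w hw
  rw [Module.End.mem_eigenspace_iff] at hw ⊢
  change T w = c • w at hw
  change T (ρ.toHom g w) = c • ρ.toHom g w
  rw [hcomm, hw, map_smul]

/-- An element of a compact group acting non-trivially in a unitary representation acts
non-trivially in some finite-dimensional irreducible subrepresentation. -/
theorem exists_irreducible_sub_ne (ρ : UnitaryRep K) {x : K} (hx : ρ.toHom x ≠ 1) :
    ∃ (E : Submodule ℂ ρ.H) (_ : FiniteDimensional ℂ E) (hE : ρ.IsInvariant E),
      (ρ.sub E hE).IsIrreducible ∧ (ρ.sub E hE).toHom x ≠ 1 := by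
  by_contra! hcon
  -- `F` consists of the vectors whose whole orbit is fixed by `x`. It contains every
  -- subrepresentation on which `x` acts trivially, so an irreducible one found inside `Fᗮ` gives a
  -- contradiction.
  let F : Submodule ℂ ρ.H := ⨅ g : K, LinearMap.eqLocus
    ((ρ.toHom x).toLinearEquiv.toLinearMap ∘ₗ (ρ.toHom g).toLinearEquiv.toLinearMap)
    (ρ.toHom g).toLinearEquiv.toLinearMap
  have memF (w : ρ.H) : w ∈ F ↔ ∀ g, ρ.toHom x (ρ.toHom g w) = ρ.toHom g w := by
    simp [F, Submodule.mem_iInf]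
  have hFc : IsClosed (F : Set ρ.H) := by
    have : (F : Set ρ.H) = ⋂ g, {w | ρ.toHom x (ρ.toHom g w) = ρ.toHom g w} := by
      ext w; simp [memF]
    rw [this]
    exact isClosed_iInter fun g => isClosed_eq
      ((ρ.toHom x).continuous.comp (ρ.toHom g).continuous) (ρ.toHom g).continuous
  have hFi : ρ.IsInvariant F := by
    intro h w hw
    rw [memF] at hw ⊢
    intro g
    simpa using hw (g * h)
  have : CompleteSpace F := hFc.completeSpace_coe
  have hbot : Fᗮ ≠ ⊥ := by
    intro h
    rw [Submodule.orthogonal_eq_bot_iff] at h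
    apply hx
    ext w
    simpa using (memF w).1 (h ▸ Submodule.mem_top) 1
  have hFo : ρ.IsInvariant Fᗮ := hFi.orthogonal
  have : Nontrivial (ρ.sub Fᗮ hFo).H := Submodule.nontrivial_iff_ne_bot.2 hbot
  obtain ⟨E₀, hE₀fin, hE₀, hE₀ne⟩ := (ρ.sub Fᗮ hFo).exists_finiteDimensional_invariant
  let E₁ : Submodule ℂ ρ.H := Submodule.map Fᗮ.subtype E₀
  have hE₁ : ρ.IsInvariant E₁ := IsInvariant.map_subtype (E := Fᗮ) (hE := hFo) hE₀
  have hE₁F : E₁ ≤ Fᗮ := Submodule.map_subtype_le _ _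
  have : FiniteDimensional ℂ E₁ := by
    have : FiniteDimensional ℂ (E₀ : Submodule ℂ Fᗮ) := hE₀fin
    exact Module.Finite.map E₀ _
  have hE₁ne : E₁ ≠ ⊥ := fun h => hE₀ne <|
    Submodule.map_injective_of_injective (Fᗮ).injective_subtype (h.trans (Submodule.map_bot _).symm)
  obtain ⟨E, hEE, hE, hE0, hEmin⟩ := ρ.exists_minimal_invariant hE₁ hE₁ne
  have : FiniteDimensional ℂ E := Submodule.finiteDimensional_of_le hEE
  have htriv := hcon E this hE (ρ.isIrreducible_sub hE hE0 hEmin)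
  have hEF : E ≤ F := by
    intro w hw
    rw [memF]
    intro g
    have := congrArg (fun T : (ρ.sub E hE).H ≃ₗᵢ[ℂ] (ρ.sub E hE).H =>
      (T (⟨ρ.toHom g w, hE g w hw⟩ : E) : E)) htriv
    exact congrArg Subtype.val this
  apply hE0
  rw [eq_bot_iff, ← F.inf_orthogonal_eq_bot]
  exact le_inf hEF (hEE.trans hE₁F)

end Compact

end UnitaryRep
-- Peter–Weyl: irreducible matrix representations separate points.
open scoped Matrix

namespace UnitaryRep

open MeasureTheory

/-- The points of a compact Hausdorff group are separated from the identity by the regular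
representation. -/
theorem exists_toHom_ne_one {K : Type u} [Group K] [TopologicalSpace K] [IsTopologicalGroup K]
    [CompactSpace K] [T2Space K] {x : K} (hx : x ≠ 1) : ∃ ρ : UnitaryRep K, ρ.toHom x ≠ 1 := by
  borelize K
  let μ : Measure K := Measure.haarMeasure ⊤
  have : Fact ((2 : ENNReal) ≠ ⊤) := ⟨by simp⟩
  let f : K → Lp ℂ 2 μ →ₗ[ℂ] Lp ℂ 2 μ := fun g =>
    -- Translation `(g • v)(y) = v(g⁻¹ y)`; the inverse turns the action on the domain into a left
    -- action.
    { toFun := fun v => DomMulAct.mk g⁻¹ • v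
      map_add' := smul_add _
      map_smul' := fun c v => smul_comm _ c v }
  let ρ : UnitaryRep K := ofLinearIsometry (Lp ℂ 2 μ) f
    (by ext1 v; simp [f])
    (fun g h => by ext1 v; simp [f, mul_smul])
    (fun g v => DomMulAct.norm_smul_Lp _ _)
    (fun v => (DomMulAct.continuous_mk.comp continuous_inv).smul continuous_const)
  refine ⟨ρ, fun h => hx ?_⟩
  by_contra hne
  -- If `x` fixed the class of this Urysohn function, then `φ(x⁻¹ g) = φ(g)` almost everywhere,
  -- hence everywhere by continuity, which fails at `g = 1`.
  obtain ⟨φ, h0, h1, -⟩ := exists_continuous_zero_one_of_isClosed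
    (isClosed_singleton (x := x⁻¹)) (isClosed_singleton (x := (1 : K)))
    (by simpa [eq_comm] using hne)
  have hφ : Continuous fun g : K => (φ g : ℂ) := by fun_prop
  have hm : MemLp (fun g : K => (φ g : ℂ)) 2 μ :=
    hφ.memLp_of_hasCompactSupport (HasCompactSupport.of_compactSpace _)
  have h2 : DomMulAct.mk x⁻¹ • hm.toLp _ = hm.toLp _ :=
    congrArg (fun T : Lp ℂ 2 μ ≃ₗᵢ[ℂ] Lp ℂ 2 μ => T (hm.toLp _)) h
  rw [DomMulAct.mk_smul_toLp, MemLp.toLp_eq_toLp_iff] at h2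
  have h3 := (Continuous.ae_eq_iff_eq μ (by fun_prop) hφ).1 h2
  have h4 := congrFun h3 1
  have e0 : φ x⁻¹ = 0 := h0 rfl
  have e1 : φ 1 = 1 := h1 rfl
  simp [e0, e1] at h4

end UnitaryRep

/-- Irreducibility of a homomorphism to a unitary matrix group. -/
def Matrix.IsIrreducibleHom {G ι : Type*} [Group G] [Fintype ι] [DecidableEq ι]
    (π : G →* Matrix.unitaryGroup ι ℂ) : Prop :=
  ∀ E : Submodule ℂ (ι → ℂ), (∀ g, ∀ v ∈ E, (π g : Matrix ι ι ℂ) *ᵥ v ∈ E) → E = ⊥ ∨ E = ⊤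

namespace UnitaryRep

/-- A finite-dimensional irreducible unitary representation in matrix form. -/
theorem IsIrreducible.exists_matrix {G : Type u} [Group G] [TopologicalSpace G]
    {ρ : UnitaryRep G} (hρ : ρ.IsIrreducible) [FiniteDimensional ℂ ρ.H] :
    ∃ (n : ℕ) (_ : 1 ≤ n)
      (π : G →* Matrix.unitaryGroup (ULift.{u} (Fin n)) ℂ), Continuous π ∧
      Matrix.IsIrreducibleHom π ∧ ∀ x, π x = 1 → ρ.toHom x = 1 := by
  have := hρ.1
  let b := (stdOrthonormalBasis ℂ ρ.H).reindex (Equiv.ulift (α := Fin (Module.finrank ℂ ρ.H))).symm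
  let M := LinearMap.toMatrixOrthonormal b
  have hstar (g : G) : star (ρ.toHom g).toLinearEquiv.toLinearMap =
      (ρ.toHom g⁻¹).toLinearEquiv.toLinearMap := by
    rw [LinearMap.star_eq_adjoint, eq_comm, LinearMap.eq_adjoint_iff]
    intro v w
    simpa using ρ.inner_toHom_left g⁻¹ v w
  have hmul (g h : G) : (ρ.toHom (g * h)).toLinearEquiv.toLinearMap =
      (ρ.toHom g).toLinearEquiv.toLinearMap * (ρ.toHom h).toLinearEquiv.toLinearMap := by
    ext v; simp
  have hone : (ρ.toHom 1).toLinearEquiv.toLinearMap = 1 := by ext v; simp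
  let π : G →* Matrix.unitaryGroup (ULift.{u} (Fin (Module.finrank ℂ ρ.H))) ℂ :=
    { toFun := fun g => ⟨M (ρ.toHom g).toLinearEquiv.toLinearMap, by
        rw [Matrix.mem_unitaryGroup_iff, ← map_star, ← map_mul, hstar, ← hmul, mul_inv_cancel,
          hone, map_one]⟩
      map_one' := Subtype.ext ((congrArg M hone).trans (map_one M))
      map_mul' := fun g h => Subtype.ext ((congrArg M (hmul g h)).trans (map_mul M _ _)) }
  have hπ (g : G) (v : ρ.H) : (π g : Matrix _ _ ℂ) *ᵥ b.repr v = b.repr (ρ.toHom g v) := by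
    have := LinearMap.toMatrix_mulVec_repr b.toBasis b.toBasis
      (ρ.toHom g).toLinearEquiv.toLinearMap v
    have hM : (π g : Matrix _ _ ℂ) = LinearMap.toMatrix b.toBasis b.toBasis
      (ρ.toHom g).toLinearEquiv.toLinearMap := rfl
    ext i
    have e : (b.toBasis.repr v : _ → ℂ) = (b.repr v).ofLp := by ext j; simp
    rw [hM, ← e, this]
    simp
  refine ⟨_, Module.finrank_pos, π, ?_, ?_, ?_⟩
  · refine Continuous.subtype_mk (continuous_matrix fun i j => ?_) _
    have := ρ.continuous_apply (b j)
    simp only [M, LinearMap.toMatrixOrthonormal_apply_apply]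
    exact continuous_const.inner this
  · intro E hE
    let e : ρ.H ≃ₗ[ℂ] (ULift.{u} (Fin (Module.finrank ℂ ρ.H)) → ℂ) :=
      b.repr.toLinearEquiv.trans (WithLp.linearEquiv 2 ℂ _)
    have := hρ.2 (E.comap e.toLinearMap) (Submodule.closed_of_finiteDimensional _) (fun g v hv => by
      have := hE g _ hv
      erw [hπ] at this
      exact this)
    refine this.imp (fun h => ?_) (fun h => ?_)
    · exact Submodule.comap_injective_of_surjective e.surjective (h.trans (by simp))
    · exact Submodule.comap_injective_of_surjective e.surjective (h.trans (by simp))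
  · intro x hx
    ext v
    apply b.repr.injective
    ext i
    rw [← hπ, hx]
    simp

/-- **Peter–Weyl**: the continuous irreducible finite-dimensional unitary representations of a
compact Hausdorff group separate points. -/
theorem _root_.exists_isIrreducibleHom_ne {K : Type u} [Group K] [TopologicalSpace K]
    [IsTopologicalGroup K] [CompactSpace K] [T2Space K] {x y : K} (hxy : x ≠ y) :
    ∃ (n : ℕ) (_ : 1 ≤ n) (π : K →* Matrix.unitaryGroup (ULift.{u} (Fin n)) ℂ),
      Continuous π ∧ Matrix.IsIrreducibleHom π ∧ π x ≠ π y := by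
  obtain ⟨ρ, hρ⟩ := exists_toHom_ne_one (x := x * y⁻¹) (by rwa [Ne, mul_inv_eq_one])
  obtain ⟨E, hEfin, hE, hirr, hne⟩ := ρ.exists_irreducible_sub_ne hρ
  obtain ⟨n, hn, π, hπc, hπi, hπ⟩ := hirr.exists_matrix
  refine ⟨n, hn, π, hπc, hπi, fun h => hne (hπ _ ?_)⟩
  rw [map_mul, map_inv, h, mul_inv_cancel]

end UnitaryRep

/-! ### From isolation of `1_G` to invariant vectors. -/

namespace UnitaryRep

variable {G : Type u} [Group G] [TopologicalSpace G]

theorem exists_const_of_mem_posCone_trivial {f : G → ℂ} (hf : f ∈ (trivial G).posCone) :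
    ∃ c : ℝ, 0 ≤ c ∧ f = fun _ => (c : ℂ) := by
  refine AddSubmonoid.closure_induction ?_ ⟨0, le_rfl, by ext; simp⟩ ?_ hf
  · rintro _ ⟨v, rfl⟩
    refine ⟨‖v‖ ^ 2, by positivity, funext fun g => ?_⟩
    change inner ℂ v v = _
    rw [inner_self_eq_norm_sq_to_K]
    norm_cast
  · rintro _ _ - - ⟨a, ha, rfl⟩ ⟨b, hb, rfl⟩
    exact ⟨a + b, add_nonneg ha hb, by ext; simp⟩

theorem const_mul_inner_mem_posCone (ρ : UnitaryRep G) (v : ρ.H) {c : ℝ} (hc : 0 ≤ c) :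
    (fun g => (c : ℂ) * inner ℂ v (ρ.toHom g v)) ∈ ρ.posCone := by
  refine AddSubmonoid.subset_closure ⟨((√c : ℝ) : ℂ) • v, funext fun g => ?_⟩
  rw [map_smul, inner_smul_left, inner_smul_right, Complex.conj_ofReal, ← mul_assoc,
    ← Complex.ofReal_mul, Real.mul_self_sqrt hc]

/-- If `1_G` is isolated among the `n`-dimensional irreducible representations, then such a
representation with almost invariant vectors is trivial. -/
theorem exists_forall_toHom_eq_self {n : ℕ}
    (hG : (RepClass.one G).IsIsolatedIn (dualObjectDim G n)) :
    ∃ C : Set G, IsCompact C ∧ ∃ δ : ℝ, 0 < δ ∧ ∀ ρ : UnitaryRep G, ρ.IsIrreducible →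
      Module.rank ℂ ρ.H = n → ∀ w : ρ.H, w ≠ 0 →
      (∀ g ∈ C, ‖ρ.toHom g w - w‖ ≤ δ * ‖w‖) → ∀ g v, ρ.toHom g v = v := by
  obtain ⟨k, f, C, ε, hf, hC, hε, h⟩ := hG _ rfl
  choose c hc hfc using fun i => exists_const_of_mem_posCone_trivial (hf i)
  have hsum : 0 ≤ ∑ i, c i := Finset.sum_nonneg fun i _ => hc i
  -- For a unit vector `w'`, the constant `c i` differs from `c i * ⟨w', ρ(g)w'⟩` by at most `c i *
  -- ‖w' - ρ(g)w'‖`. The summand `1` avoids division by zero and makes the final bound strict.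
  refine ⟨C, hC, ε / (1 + ∑ i, c i), by positivity, fun ρ hρ hn w hw hwC => ?_⟩
  have hmem : RepClass.mk ρ ∈ dualObjectDim G n ∪ {RepClass.one G} :=
    Or.inl ⟨⟨ρ, rfl, hρ⟩, ρ, rfl, hn⟩
  have hw0 : 0 < ‖w‖ := norm_pos_iff.2 hw
  have hnb : (⟨RepClass.mk ρ, hmem⟩ : ↥(dualObjectDim G n ∪ {RepClass.one G})) ∈
      RepClass.fellNhd _ f C ε := by
    let w' : ρ.H := ((‖w‖⁻¹ : ℝ) : ℂ) • w
    have hw' : ‖w'‖ = 1 := by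
      simp only [w', norm_smul, Complex.norm_real, norm_inv, norm_norm]
      exact inv_mul_cancel₀ hw0.ne'
    refine ⟨fun i g => (c i : ℂ) * inner ℂ w' (ρ.toHom g w'),
      fun i => ρ.const_mul_inner_mem_posCone w' (hc i), fun g hg i => ?_⟩
    have h1 : inner ℂ w' w' = (1 : ℂ) := by
      rw [inner_self_eq_norm_sq_to_K, hw']; simp
    have h2 : ‖w' - ρ.toHom g w'‖ ≤ ε / (1 + ∑ i, c i) := by
      have : w' - ρ.toHom g w' = ((‖w‖⁻¹ : ℝ) : ℂ) • (w - ρ.toHom g w) := by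
        simp only [w', map_smul, smul_sub]
      rw [this, norm_smul, Complex.norm_real, norm_inv, norm_norm, norm_sub_rev,
        inv_mul_le_iff₀ hw0, mul_comm]
      exact hwC g hg
    have h3 : f i g - c i * inner ℂ w' (ρ.toHom g w') =
        c i * inner ℂ w' (w' - ρ.toHom g w') := by
      rw [inner_sub_right, h1, hfc i]; ring
    rw [h3, norm_mul, Complex.norm_real, Real.norm_of_nonneg (hc i)]
    have h4 : ‖inner ℂ w' (w' - ρ.toHom g w')‖ ≤ ε / (1 + ∑ i, c i) :=
      (norm_inner_le_norm _ _).trans (by rwa [hw', one_mul])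
    have h5 : c i ≤ ∑ i, c i := Finset.single_le_sum (fun i _ => hc i) (Finset.mem_univ i)
    calc c i * ‖inner ℂ w' (w' - ρ.toHom g w')‖
        ≤ (∑ i, c i) * (ε / (1 + ∑ i, c i)) := mul_le_mul h5 h4 (norm_nonneg _) hsum
      _ < ε := by
        rw [mul_div_assoc', div_lt_iff₀ (by positivity)]
        nlinarith
  have heq : RepClass.mk ρ = RepClass.one G := congrArg Subtype.val (h hnb)
  obtain ⟨M, hM⟩ : ρ.Equivalent (trivial G) := Quotient.exact heq
  intro g v
  exact M.injective ((hM g v).trans rfl)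

/-- The constituents of a reducible representation may have any smaller dimension, so one pair `(C,
δ)` must serve all of them: take the union of the compact sets and the minimum of the constants. -/
theorem exists_forall_toHom_eq_self_of_rank_le
    (hG : ∀ n : ℕ, 1 ≤ n → (RepClass.one G).IsIsolatedIn (dualObjectDim G n)) (N : ℕ) :
    ∃ C : Set G, IsCompact C ∧ ∃ δ : ℝ, 0 < δ ∧ ∀ ρ : UnitaryRep G, ρ.IsIrreducible →
      ∀ n : ℕ, 1 ≤ n → n ≤ N → Module.rank ℂ ρ.H = n → ∀ w : ρ.H, w ≠ 0 →
      (∀ g ∈ C, ‖ρ.toHom g w - w‖ ≤ δ * ‖w‖) → ∀ g v, ρ.toHom g v = v := by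
  induction N with
  | zero => exact ⟨∅, isCompact_empty, 1, one_pos, fun ρ _ n h1 h2 => by omega⟩
  | succ N ih =>
    obtain ⟨C, hC, δ, hδ, h⟩ := ih
    obtain ⟨C', hC', δ', hδ', h'⟩ := exists_forall_toHom_eq_self (hG (N + 1) (by omega))
    refine ⟨C ∪ C', hC.union hC', min δ δ', lt_min hδ hδ', fun ρ hρ n h1 hn hr w hw hb => ?_⟩
    rcases Nat.lt_or_ge N n with hlt | hle
    · obtain rfl : n = N + 1 := by omega
      exact h' ρ hρ hr w hw fun g hg => (hb g (Or.inr hg)).trans <| by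
        gcongr; exact min_le_right _ _
    · exact h ρ hρ n h1 hle hr w hw fun g hg => (hb g (Or.inl hg)).trans <| by
        gcongr; exact min_le_left _ _

theorem norm_le_norm_add_of_orthogonal {H : Type*} [NormedAddCommGroup H] [InnerProductSpace ℂ H]
    {F : Submodule ℂ H} {a b : H} (ha : a ∈ F) (hb : b ∈ Fᗮ) :
    ‖a‖ ≤ ‖a + b‖ ∧ ‖b‖ ≤ ‖a + b‖ := by
  have := norm_add_sq_eq_norm_sq_add_norm_sq_of_inner_eq_zero (𝕜 := ℂ) a b (hb a ha)
  constructor <;> nlinarith [norm_nonneg a, norm_nonneg b, norm_nonneg (a + b)]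

/-- An invariant subspace with a sufficiently invariant vector contains a non-zero invariant
vector, if this holds for irreducible representations. -/
theorem exists_invariant_vector {C : Set G} {δ : ℝ} {N : ℕ}
    (h : ∀ ρ : UnitaryRep G, ρ.IsIrreducible → ∀ n : ℕ, 1 ≤ n → n ≤ N → Module.rank ℂ ρ.H = n →
      ∀ w : ρ.H, w ≠ 0 → (∀ g ∈ C, ‖ρ.toHom g w - w‖ ≤ δ * ‖w‖) → ∀ g v, ρ.toHom g v = v)
    (hδ : 0 < δ) (ρ : UnitaryRep G) [FiniteDimensional ℂ ρ.H] (d : ℕ) (hd : d ≤ N)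
    (E : Submodule ℂ ρ.H) (hE : ρ.IsInvariant E) (hEd : Module.finrank ℂ E ≤ d)
    (v : ρ.H) (hv : v ∈ E) (hv0 : v ≠ 0)
    (hC : ∀ g ∈ C, ‖ρ.toHom g v - v‖ ≤ δ / 2 ^ d * ‖v‖) :
    ∃ u : ρ.H, u ≠ 0 ∧ ∀ g, ρ.toHom g u = u := by
  induction d generalizing E v with
  | zero =>
    have : E = ⊥ := Submodule.finrank_eq_zero.1 (by omega)
    exact absurd (by simpa [this] using hv) hv0
  | succ d ih =>
    have hEne : E ≠ ⊥ := fun h0 => hv0 (by simpa [h0] using hv)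
    by_cases hmin : ∀ F ≤ E, ρ.IsInvariant F → F = ⊥ ∨ F = E
    -- Here `E` is irreducible, so the action on it is trivial and `v` itself is fixed.
    · refine ⟨v, hv0, fun g => ?_⟩
      have hpos : 1 ≤ Module.finrank ℂ E := Submodule.one_le_finrank_iff.2 hEne
      have := h _ (ρ.isIrreducible_sub hE hEne hmin) (Module.finrank ℂ E) hpos (hEd.trans hd)
        (Module.finrank_eq_rank ℂ E).symm (⟨v, hv⟩ : E) (by simpa using hv0)
        (fun g hg => (hC g hg).trans <| by
          have : (1 : ℝ) ≤ 2 ^ (d + 1) := one_le_pow₀ (by norm_num)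
          change _ ≤ δ * ‖v‖
          gcongr
          exact div_le_self hδ.le this) g (⟨v, hv⟩ : E)
      exact congrArg E.subtype this
    · push Not at hmin
      obtain ⟨F, hFE, hF, hF0, hFne⟩ := hmin
      have hlt : F < E := lt_of_le_of_ne hFE hFne
      obtain ⟨a, ha, b, hb, rfl⟩ := F.exists_add_mem_mem_orthogonal v
      have hbE : b ∈ E := by simpa using E.sub_mem hv (hFE ha)
      have hF' : ρ.IsInvariant (Fᗮ ⊓ E) := fun g w hw => ⟨hF.orthogonal g w hw.1, hE g w hw.2⟩
      have hlt' : Fᗮ ⊓ E < E := by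
        refine lt_of_le_of_ne inf_le_right fun h0 => hF0 ?_
        rw [eq_bot_iff, ← F.inf_orthogonal_eq_bot]
        exact le_inf le_rfl (hFE.trans (h0 ▸ inf_le_left))
      have key (g : G) : ‖ρ.toHom g a - a‖ ≤ ‖ρ.toHom g (a + b) - (a + b)‖ ∧
          ‖ρ.toHom g b - b‖ ≤ ‖ρ.toHom g (a + b) - (a + b)‖ := by
        have e : ρ.toHom g (a + b) - (a + b) = (ρ.toHom g a - a) + (ρ.toHom g b - b) := by
          rw [map_add]; abel
        rw [e]
        exact norm_le_norm_add_of_orthogonal (F.sub_mem (hF g a ha) ha)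
          (Fᗮ.sub_mem (hF.orthogonal g b hb) hb)
      have hab := norm_add_le a b
      have hpos : 0 < ‖a + b‖ := norm_pos_iff.2 hv0
      -- The larger of the two orthogonal components has at least half the norm of `v` and is moved
      -- no farther than `v`. Each splitting therefore costs at most a factor `2`, which is the
      -- source of `2 ^ d`.
      have bound {x : ρ.H} (hx : ‖a + b‖ ≤ 2 * ‖x‖)
          (hxk : ∀ g, ‖ρ.toHom g x - x‖ ≤ ‖ρ.toHom g (a + b) - (a + b)‖) :
          ∀ g ∈ C, ‖ρ.toHom g x - x‖ ≤ δ / 2 ^ d * ‖x‖ := by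
        intro g hg
        refine ((hxk g).trans (hC g hg)).trans ?_
        calc δ / 2 ^ (d + 1) * ‖a + b‖ ≤ δ / 2 ^ (d + 1) * (2 * ‖x‖) := by gcongr
          _ = δ / 2 ^ d * ‖x‖ := by rw [pow_succ]; field_simp
      rcases le_total ‖b‖ ‖a‖ with hle | hle
      · exact ih (by omega) F hF (by have := Submodule.finrank_lt_finrank_of_lt hlt; omega) a ha
          (norm_pos_iff.1 (by linarith)) (bound (by linarith) fun g => (key g).1)
      · exact ih (by omega) _ hF' (by have := Submodule.finrank_lt_finrank_of_lt hlt'; omega) b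
          ⟨hb, hbE⟩ (norm_pos_iff.1 (by linarith)) (bound (by linarith) fun g => (key g).2)

end UnitaryRep

/-! ### The Hilbert–Schmidt norm and Schur's argument. -/

namespace Matrix

variable {ι : Type u} [Fintype ι]

/-- Matrices as vectors of a Euclidean space. -/
def toEuclidean (ι : Type u) [Fintype ι] : Matrix ι ι ℂ ≃ₗ[ℂ] EuclideanSpace ℂ (ι × ι) :=
  (LinearEquiv.curry ℂ ℂ ι ι).symm.trans (WithLp.linearEquiv 2 ℂ _).symm

theorem norm_toEuclidean_sq (A : Matrix ι ι ℂ) :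
    ((‖toEuclidean ι A‖ ^ 2 : ℝ) : ℂ) = (Aᴴ * A).trace := by
  rw [EuclideanSpace.norm_sq_eq, Fintype.sum_prod_type_right]
  push_cast
  simp only [trace, diag, mul_apply, conjTranspose_apply]
  refine Finset.sum_congr rfl fun i _ => Finset.sum_congr rfl fun j _ => ?_
  exact (RCLike.conj_mul (A j i)).symm

theorem continuous_toEuclidean : Continuous (toEuclidean ι) :=
  (toEuclidean ι).toLinearMap.continuous_of_finiteDimensional

variable [DecidableEq ι]

theorem norm_toEuclidean_mul_mul (P Q : unitaryGroup ι ℂ) (A : Matrix ι ι ℂ) :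
    ‖toEuclidean ι (P * A * star (Q : Matrix ι ι ℂ))‖ = ‖toEuclidean ι A‖ := by
  rw [← sq_eq_sq₀ (norm_nonneg _) (norm_nonneg _), ← Complex.ofReal_inj, norm_toEuclidean_sq,
    norm_toEuclidean_sq]
  have hP : (P : Matrix ι ι ℂ)ᴴ * P = 1 := UnitaryGroup.star_mul_self P
  have hQ : (Q : Matrix ι ι ℂ)ᴴ * Q = 1 := UnitaryGroup.star_mul_self Q
  rw [star_eq_conjTranspose, conjTranspose_mul, conjTranspose_mul, conjTranspose_conjTranspose]
  rw [show (Q : Matrix ι ι ℂ) * (Aᴴ * (P : Matrix ι ι ℂ)ᴴ) * (P * A * (Q : Matrix ι ι ℂ)ᴴ) =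
    Q * (Aᴴ * ((P : Matrix ι ι ℂ)ᴴ * P) * A * (Q : Matrix ι ι ℂ)ᴴ) by simp only [mul_assoc],
    trace_mul_comm, hP, mul_one, mul_assoc, hQ, mul_one]

/-- Two irreducible unitary matrix representations with a non-zero intertwiner have the same
fibres. -/
theorem IsIrreducibleHom.eq_of_intertwine {G : Type*} [Group G]
    {U V : G →* unitaryGroup ι ℂ} (hU : IsIrreducibleHom U) {A : Matrix ι ι ℂ} (hA : A ≠ 0)
    (h : ∀ g, (V g : Matrix ι ι ℂ) * A = A * U g) {x y : G} (hxy : U x = U y) : V x = V y := by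
  -- The kernel of an intertwiner is `U`-invariant. As `A` is square, injectivity makes it
  -- invertible.
  have hker : LinearMap.ker A.mulVecLin = ⊥ := by
    refine (hU _ fun g v hv => ?_).resolve_right fun htop => hA ?_
    · rw [LinearMap.mem_ker, mulVecLin_apply] at hv ⊢
      rw [mulVec_mulVec, ← h, ← mulVec_mulVec, hv, mulVec_zero]
    · rw [LinearMap.ker_eq_top] at htop
      exact toLin'.injective (by simpa [toLin'_apply'] using htop)
  have hunit : IsUnit A := mulVec_injective_iff_isUnit.1 (LinearMap.ker_eq_bot.1 hker)
  apply Subtype.ext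
  apply hunit.mul_right_cancel
  rw [h, h, hxy]

end Matrix

/-! ### Nearby representations are intertwined. -/

namespace UnitaryRep

variable {G : Type u} [Group G] [TopologicalSpace G] {ι : Type u} [Fintype ι] [DecidableEq ι]

open Matrix

/-- The representation `A ↦ V g * A * (U g)⁻¹` on matrices. -/
noncomputable abbrev homRep (U V : G →* unitaryGroup ι ℂ) (hU : Continuous U)
    (hV : Continuous V) : UnitaryRep G :=
  ofLinearIsometry (EuclideanSpace ℂ (ι × ι))
    (fun g => (toEuclidean ι).toLinearMap ∘ₗ
      (LinearMap.mulLeft ℂ (V g : Matrix ι ι ℂ) ∘ₗ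
        LinearMap.mulRight ℂ (star (U g : Matrix ι ι ℂ))) ∘ₗ (toEuclidean ι).symm.toLinearMap)
    (by ext1 v; simp)
    (fun g h => by ext1 v; simp [mul_assoc])
    (fun g v => by
      have := norm_toEuclidean_mul_mul (V g) (U g) ((toEuclidean ι).symm v)
      simpa [mul_assoc] using this)
    (fun v => by
      refine continuous_toEuclidean.comp ?_
      have h1 : Continuous fun g => (V g : Matrix ι ι ℂ) := continuous_subtype_val.comp hV
      have h2 : Continuous fun g => (U g : Matrix ι ι ℂ) := continuous_subtype_val.comp hU
      exact h1.mul (continuous_const.mul h2.star))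

/-- The intertwiners are the fixed vectors of `homRep U V`, and `‖V(g) U(g)* - 1‖ = ‖V(g) - U(g)‖`
in the Hilbert–Schmidt norm. So closeness on `C` makes the identity matrix almost invariant; its
norm enters the constant because almost invariance is relative to the length of the vector. -/
theorem exists_intertwiner
    (hG : ∀ n : ℕ, 1 ≤ n → (RepClass.one G).IsIsolatedIn (dualObjectDim G n)) [Nonempty ι] :
    ∃ C : Set G, IsCompact C ∧ ∃ δ : ℝ, 0 < δ ∧ ∀ U V : G →* unitaryGroup ι ℂ,
      Continuous U → Continuous V →
      (∀ g ∈ C, ‖toEuclidean ι (V g) - toEuclidean ι (U g)‖ ≤ δ) →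
      ∃ A : Matrix ι ι ℂ, A ≠ 0 ∧ ∀ g, (V g : Matrix ι ι ℂ) * A = A * U g := by
  obtain ⟨C, hC, δ, hδ, h⟩ :=
    exists_forall_toHom_eq_self_of_rank_le hG (Fintype.card (ι × ι))
  have h1 : toEuclidean ι 1 ≠ 0 := by simp
  have h1' : 0 < ‖toEuclidean ι 1‖ := norm_pos_iff.2 h1
  refine ⟨C, hC, δ / 2 ^ Fintype.card (ι × ι) * ‖toEuclidean ι 1‖, by positivity,
    fun U V hU hV hUV => ?_⟩
  have happ (g : G) (A : Matrix ι ι ℂ) : (homRep U V hU hV).toHom g (toEuclidean ι A) =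
      toEuclidean ι (V g * (A * star (U g : Matrix ι ι ℂ))) := by
    change toEuclidean ι (V g * ((toEuclidean ι).symm (toEuclidean ι A) * _)) = _
    rw [LinearEquiv.symm_apply_apply]
  obtain ⟨u, hu0, hu⟩ := exists_invariant_vector h hδ (homRep U V hU hV) _ le_rfl ⊤
    (fun _ _ _ => Submodule.mem_top) (by simp) (toEuclidean ι 1) Submodule.mem_top h1 (by
      intro g hg
      refine le_trans (le_of_eq ?_) (hUV g hg)
      rw [happ, ← map_sub, ← map_sub, one_mul]
      have e : (V g : Matrix ι ι ℂ) * star (U g : Matrix ι ι ℂ) - 1 =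
          ((1 : unitaryGroup ι ℂ) : Matrix ι ι ℂ) * ((V g : Matrix ι ι ℂ) - U g) *
            star (U g : Matrix ι ι ℂ) := by
        rw [OneMemClass.coe_one, one_mul, sub_mul]
        congr 1
        exact (mem_unitaryGroup_iff.1 (U g).2).symm
      rw [e, norm_toEuclidean_mul_mul])
  obtain ⟨A, rfl⟩ := (toEuclidean ι).surjective u
  refine ⟨A, fun h0 => hu0 (by simp [h0]), fun g => ?_⟩
  have := (toEuclidean ι).injective ((happ g A).symm.trans (hu g))
  calc (V g : Matrix ι ι ℂ) * A
      = V g * (A * star (U g : Matrix ι ι ℂ)) * U g := by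
        rw [mul_assoc, mul_assoc, UnitaryGroup.star_mul_self, mul_one]
    _ = A * U g := by rw [this]

end UnitaryRep

/-! ### Cardinal estimates for weights and function families. -/

section Weight

open TopologicalSpace Cardinal

theorem weight_le_mk {X : Type u} [TopologicalSpace X] {B : Set (Set X)}
    (hB : IsTopologicalBasis B) : weight X ≤ #B :=
  csInf_le' ⟨B, hB, rfl⟩

theorem exists_isTopologicalBasis_mk_eq_weight (X : Type u) [TopologicalSpace X] :
    ∃ B : Set (Set X), IsTopologicalBasis B ∧ #B = weight X :=
  csInf_mem (s := {c : Cardinal.{u} | ∃ B : Set (Set X), IsTopologicalBasis B ∧ #B = c})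
    ⟨_, _, isTopologicalBasis_opens, rfl⟩

theorem weight_le_mk_of_discrete (X : Type u) [TopologicalSpace X] [DiscreteTopology X] :
    weight X ≤ #X :=
  (weight_le_mk (isTopologicalBasis_singletons X)).trans <|
    (mk_le_mk_of_subset (by rintro s ⟨x, rfl⟩; exact ⟨x, rfl⟩)).trans
      (mk_range_le (f := fun x : X => ({x} : Set X)))

theorem mk_le_weight_of_discrete (X : Type u) [TopologicalSpace X] [DiscreteTopology X] :
    #X ≤ weight X := by
  obtain ⟨B, hB, hBX⟩ := exists_isTopologicalBasis_mk_eq_weight X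
  have h (x : X) : {x} ∈ B := by
    obtain ⟨b, hb, hx, hbx⟩ := hB.exists_subset_of_mem_open (Set.mem_singleton x) (isOpen_discrete _)
    rwa [← Set.Subset.antisymm hbx (Set.singleton_subset_iff.2 hx)]
  rw [← hBX]
  exact mk_le_of_injective (f := fun x => (⟨{x}, h x⟩ : B))
    fun x y hxy => Set.singleton_injective (congrArg Subtype.val hxy)

theorem weight_le_aleph0 (X : Type u) [TopologicalSpace X] [SecondCountableTopology X] :
    weight X ≤ ℵ₀ :=
  (weight_le_mk (isBasis_countableBasis X)).trans (mk_le_aleph0_iff.2 (countable_countableBasis X))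

theorem secondCountableTopology_of_weight_le {X : Type u} [TopologicalSpace X]
    (h : weight X ≤ ℵ₀) : SecondCountableTopology X := by
  obtain ⟨B, hB, hBX⟩ := exists_isTopologicalBasis_mk_eq_weight X
  exact hB.secondCountableTopology (mk_le_aleph0_iff.1 (hBX.trans_le h))

theorem mk_finset_le {α : Type u} {κ : Cardinal.{u}} (hκ : ℵ₀ ≤ κ) (h : #α ≤ κ) :
    #(Finset α) ≤ κ := by
  classical
  exact ((mk_le_of_surjective List.toFinset_surjective).trans (mk_list_le_max α)).trans
    (max_le hκ h)

theorem mk_prod_le {α : Type u} {β : Type} [Countable β] {κ : Cardinal.{u}} (hκ : ℵ₀ ≤ κ)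
    (h : #α ≤ κ) : #(α × ULift.{u} β) ≤ κ := by
  rw [mk_prod, lift_id'.{u}, lift_id'.{u}]
  exact (mul_le_mul' h (mk_le_aleph0.trans hκ)).trans (mul_eq_self hκ).le

/-- A compact space has small weight if few continuous functions separate its points. -/
theorem weight_le_of_separates_points {X ι : Type u} [TopologicalSpace X] [CompactSpace X]
    {κ : Cardinal.{u}} (hκ : ℵ₀ ≤ κ) (hι : #ι ≤ κ) (f : ι → X → ℂ) (hf : ∀ i, Continuous (f i))
    (hsep : ∀ x y, (∀ i, f i x = f i y) → x = y) : weight X ≤ κ := by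
  classical
  let F : X → ι → ℂ := fun x i => f i x
  have hF : Topology.IsClosedEmbedding F :=
    (continuous_pi hf).isClosedEmbedding fun x y h => hsep x y (congrFun h)
  have hB := (isTopologicalBasis_pi fun _ : ι => isBasis_countableBasis ℂ).isInducing
    hF.isInducing
  have : Countable (countableBasis ℂ) := (countable_countableBasis ℂ).to_subtype
  -- Every basic open set of the product restricts to some `c P`, and there are at most `κ` finite
  -- sets `P`.
  let c : Finset (ι × ULift.{u} (countableBasis ℂ)) → Set X :=
    fun P => {x | ∀ p ∈ P, f p.1 x ∈ (p.2.down : Set ℂ)}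
  refine (weight_le_mk hB).trans <| (mk_le_mk_of_subset (t := Set.range c) ?_).trans <|
    mk_range_le.trans (mk_finset_le hκ (mk_prod_le hκ hι))
  rintro _ ⟨_, ⟨U, S, hU, rfl⟩, rfl⟩
  refine ⟨S.attach.image fun i => (i.1, ⟨⟨U i.1, hU i.1 i.2⟩⟩), ?_⟩
  ext x
  change (∀ p ∈ S.attach.image (fun i => ((i.1, ⟨⟨U i.1, hU i.1 i.2⟩⟩) :
    ι × ULift.{u} (TopologicalSpace.countableBasis ℂ))), f p.1 x ∈ (p.2.down : Set ℂ)) ↔ ∀ i ∈ S, f i x ∈ U i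
  simp only [Finset.forall_mem_image, Finset.mem_attach, true_imp_iff, Subtype.forall]

/-- A family of continuous functions from a compact space of small weight to a separable metric
space has a small subfamily that is uniformly `ε`-dense in it. -/
theorem exists_small_uniformly_dense {X A : Type u} {Y : Type*} [TopologicalSpace X]
    [CompactSpace X] [PseudoMetricSpace Y] [SeparableSpace Y] [Nonempty Y]
    {κ : Cardinal.{u}} (hκ : ℵ₀ ≤ κ)
    (hX : weight X ≤ κ) (F : A → X → Y) (hF : ∀ a, Continuous (F a)) {ε : ℝ} (hε : 0 < ε) :
    ∃ J : Set A, #J ≤ κ ∧ ∀ a, ∃ b ∈ J, ∀ x, dist (F a x) (F b x) ≤ ε := by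
  classical
  obtain ⟨B, hB, hBX⟩ := exists_isTopologicalBasis_mk_eq_weight X
  let d : ℕ → Y := denseSeq Y
  -- `P` is a finite code for `F a`: a cover by basic sets, on each of which `F a` stays within `ε /
  -- 2` of a chosen point. Functions sharing a code are `ε`-close, and there are at most `κ` codes,
  -- so one function per code suffices.
  let R (P : Finset (B × ULift.{u} ℕ)) (a : A) : Prop :=
    (∀ x, ∃ p ∈ P, x ∈ (p.1 : Set X)) ∧ ∀ p ∈ P, ∀ x ∈ (p.1 : Set X), dist (F a x) (d p.2.down) < ε / 2
  have hR (a : A) : ∃ P, R P a := by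
    have hx (x : X) : ∃ p : B × ULift.{u} ℕ, x ∈ (p.1 : Set X) ∧
        ∀ y ∈ (p.1 : Set X), dist (F a y) (d p.2.down) < ε / 2 := by
      obtain ⟨n, hn⟩ := (denseRange_denseSeq Y).exists_dist_lt (F a x) (half_pos hε)
      have ho : IsOpen {y | dist (F a y) (d n) < ε / 2} :=
        isOpen_lt ((hF a).dist continuous_const) continuous_const
      obtain ⟨b, hb, hxb, hbs⟩ := hB.exists_subset_of_mem_open (show x ∈ _ from hn) ho
      exact ⟨(⟨b, hb⟩, ⟨n⟩), hxb, fun y hy => hbs hy⟩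
    choose p hp hp' using hx
    obtain ⟨t, ht⟩ := isCompact_univ.elim_finite_subcover (fun x => ((p x).1 : Set X))
      (fun x => hB.isOpen (p x).1.2) fun x _ => Set.mem_iUnion.2 ⟨x, hp x⟩
    refine ⟨t.image p, fun x => ?_, fun q hq y hy => ?_⟩
    · obtain ⟨z, hz, hxz⟩ := Set.mem_iUnion₂.1 (ht (Set.mem_univ x))
      exact ⟨p z, Finset.mem_image_of_mem p hz, hxz⟩
    · obtain ⟨z, -, rfl⟩ := Finset.mem_image.1 hq
      exact hp' z y hy
  have hchoice : ∀ P : {P // ∃ a, R P a}, R P.1 P.2.choose := fun P => P.2.choose_spec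
  refine ⟨Set.range fun P : {P // ∃ a, R P a} => P.2.choose, ?_, fun a => ?_⟩
  · exact mk_range_le.trans <| (mk_subtype_le _).trans <|
      mk_finset_le hκ (mk_prod_le hκ (hBX.trans_le hX))
  · obtain ⟨P, hP⟩ := hR a
    refine ⟨_, ⟨⟨P, a, hP⟩, rfl⟩, fun x => ?_⟩
    have hQ := hchoice ⟨P, a, hP⟩
    obtain ⟨p, hp, hx⟩ := hP.1 x
    have h1 := hP.2 p hp x hx
    have h2 := hQ.2 p hp x hx
    exact (dist_triangle_right _ _ _).trans (by dsimp only at h2 ⊢; linarith)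

end Weight

/-! ### The canonical map into `bG`. -/

section Bohr

variable (G : Type u) [Group G] [TopologicalSpace G]

/-- The canonical homomorphism to the Bohr compactification. -/
noncomputable def toBohr : G →* BohrCompactification G :=
  AddMonoidHom.toMultiplicative
    (UniformSpace.Completion.toCompl (α := Additive (BohrGroup G)) :
      Additive G →+ UniformSpace.Completion (Additive (BohrGroup G)))

theorem continuous_toBohr : Continuous (toBohr G) := by
  have h1 : @Continuous G G _ (bohrTopology G) id :=
    continuous_id_iff_le.2 (bohrTopology_isLeast G).1.1
  exact (UniformSpace.Completion.continuous_coe (Additive (BohrGroup G))).comp h1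

theorem denseRange_toBohr : DenseRange (toBohr G) :=
  UniformSpace.Completion.denseRange_coe (α := Additive (BohrGroup G))

end Bohr

/-! ### Weight of the Bohr compactification. -/

section Main

open Cardinal Matrix

variable {G : Type u} [Group G] [TopologicalSpace G]

/-- Under the isolation hypothesis, the irreducible `ι`-dimensional representations of the Bohr
compactification have, up to having the same fibres, few members. -/
theorem exists_small_representatives
    (hG : ∀ n : ℕ, 1 ≤ n → (RepClass.one G).IsIsolatedIn (dualObjectDim G n))
    {κ : Cardinal.{u}} (hκ : ℵ₀ ≤ κ) (hK : ∀ K : Set G, IsCompact K → weight K ≤ κ)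
    (ι : Type u) [Fintype ι] [DecidableEq ι] [Nonempty ι] :
    ∃ J : Set (BohrCompactification G →* unitaryGroup ι ℂ), #J ≤ κ ∧ (∀ π ∈ J, Continuous π) ∧
      ∀ π : BohrCompactification G →* unitaryGroup ι ℂ, Continuous π → IsIrreducibleHom π →
        ∀ x y, (∀ τ ∈ J, τ x = τ y) → π x = π y := by
  obtain ⟨C, hC, δ, hδ, h⟩ := UnitaryRep.exists_intertwiner (ι := ι) hG
  have : CompactSpace C := isCompact_iff_compactSpace.1 hC
  let A := {π : BohrCompactification G →* unitaryGroup ι ℂ // Continuous π ∧ IsIrreducibleHom π}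
  obtain ⟨J, hJ, hJd⟩ := exists_small_uniformly_dense hκ (hK C hC)
    (fun (π : A) (g : C) => toEuclidean ι (π.1 (toBohr G g)))
    (fun π => continuous_toEuclidean.comp <| continuous_subtype_val.comp <|
      π.2.1.comp <| (continuous_toBohr G).comp continuous_subtype_val) hδ
  refine ⟨Subtype.val '' J, mk_image_le.trans hJ, ?_, fun π hπ hπi x y hxy => ?_⟩
  · rintro _ ⟨π, -, rfl⟩
    exact π.2.1
  obtain ⟨τ, hτ, hd⟩ := hJd ⟨π, hπ, hπi⟩
  obtain ⟨B, hB0, hB⟩ := h (τ.1.comp (toBohr G)) (π.comp (toBohr G))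
    (τ.2.1.comp (continuous_toBohr G)) (hπ.comp (continuous_toBohr G))
    (fun g hg => by simpa [dist_eq_norm] using hd ⟨g, hg⟩)
  refine τ.2.2.eq_of_intertwine hB0 (fun z => ?_) (hxy _ ⟨τ, hτ, rfl⟩)
  have h1 : Continuous fun z => (π z : Matrix ι ι ℂ) := continuous_subtype_val.comp hπ
  have h2 : Continuous fun z => (τ.1 z : Matrix ι ι ℂ) := continuous_subtype_val.comp τ.2.1
  -- The intertwining relation is known on the image of `G` and extends to `bG` by density.
  exact congrFun ((denseRange_toBohr G).equalizer (h1.mul continuous_const)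
    (continuous_const.mul h2) (funext hB)) z

theorem weight_bohrCompactification_le
    (hG : ∀ n : ℕ, 1 ≤ n → (RepClass.one G).IsIsolatedIn (dualObjectDim G n))
    {κ : Cardinal.{u}} (hκ : ℵ₀ ≤ κ) (hK : ∀ K : Set G, IsCompact K → weight K ≤ κ) :
    weight (BohrCompactification G) ≤ κ := by
  choose J hJ hJc hJs using fun n : ℕ =>
    exists_small_representatives hG hκ hK (ULift.{u} (Fin (n + 1)))
  let I := Σ n : ℕ, J n × ULift.{u} (Fin (n + 1) × Fin (n + 1))
  have hI : #I ≤ κ := by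
    rw [mk_sigma]
    refine (sum_le_sum _ (fun _ => κ) fun n => mk_prod_le hκ (hJ n)).trans ?_
    rw [sum_const]
    simpa using (mul_le_mul' hκ le_rfl).trans (mul_eq_self hκ).le
  refine weight_le_of_separates_points hκ hI
    (fun i x => (i.2.1.1 x).1 ⟨i.2.2.down.1⟩ ⟨i.2.2.down.2⟩) (fun i => ?_)
    fun x y hxy => ?_
  · have : Continuous fun x => (i.2.1.1 x).1 :=
      continuous_subtype_val.comp (hJc _ _ i.2.1.2)
    exact this.matrix_elem _ _
  · by_contra hne
    obtain ⟨n, hn, π, hπ, hπi, hπne⟩ := exists_isIrreducibleHom_ne hne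
    obtain ⟨m, rfl⟩ := Nat.exists_eq_add_of_le' hn
    refine hπne (hJs m π hπ hπi x y fun τ hτ => Subtype.ext ?_)
    ext ⟨a⟩ ⟨b⟩
    exact hxy ⟨m, ⟨τ, hτ⟩, ⟨a, b⟩⟩

/-- Finite subsets of `G` are compact and discrete, so their weight is their cardinality and `G` has
at most `n` points. Its dense image in `bG` is finite, hence closed, hence all of `bG`. -/
theorem weight_bohrCompactification_le_of_finite [T2Space G] {n : ℕ}
    (hK : ∀ K : Set G, IsCompact K → weight K ≤ n) :
    weight (BohrCompactification G) ≤ n := by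
  have hcard : #G ≤ n := card_le_of fun s => by
    have h := (mk_le_weight_of_discrete (s : Set G)).trans (hK s s.finite_toSet.isCompact)
    simpa using h
  have : Finite G := lt_aleph0_iff_finite.1 (hcard.trans_lt (natCast_lt_aleph0))
  have hsurj : Function.Surjective (toBohr G) := by
    rw [← Set.range_eq_univ, ← (denseRange_toBohr G).closure_range,
      (Set.finite_range _).isClosed.closure_eq]
  have : Finite (BohrCompactification G) := Finite.of_surjective _ hsurj
  exact (weight_le_mk_of_discrete _).trans ((mk_le_of_surjective hsurj).trans hcard)

end Main

theorem mainTheorem6 (G : Type u) [Group G] [TopologicalSpace G] [IsTopologicalGroup G]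
    [T2Space G]
    (hG : ∀ n : ℕ, 1 ≤ n → (RepClass.one G).IsIsolatedIn (dualObjectDim G n)) :
    (∀ κ : Cardinal.{u}, (∀ K : Set G, IsCompact K → weight K ≤ κ) →
      weight (BohrCompactification G) ≤ κ) ∧
    ((∀ K : Set G, IsCompact K → TopologicalSpace.MetrizableSpace K) →
      TopologicalSpace.MetrizableSpace (BohrCompactification G)) := by
  refine ⟨fun κ hκ => ?_, fun hK => ?_⟩
  · rcases le_or_gt Cardinal.aleph0 κ with h | h
    · exact weight_bohrCompactification_le hG h hκ
    · obtain ⟨n, rfl⟩ := Cardinal.lt_aleph0.1 h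
      exact weight_bohrCompactification_le_of_finite hκ
  -- Compact metrizable sets are second countable, so the first part's infinite case applies with `κ
  -- = ℵ₀`; Urysohn's metrization theorem then handles `bG`.
  · have h : weight (BohrCompactification G) ≤ Cardinal.aleph0 := by
      refine weight_bohrCompactification_le hG le_rfl fun K hKc => ?_
      have := hK K hKc
      have : CompactSpace K := isCompact_iff_compactSpace.1 hKc
      let _ := TopologicalSpace.metrizableSpaceMetric K
      exact weight_le_aleph0 K
    have := secondCountableTopology_of_weight_le h
    exact TopologicalSpace.metrizableSpace_of_t3_secondCountable _
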